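/- Let $0\le n\le d$ and let $Q\in\mathbb Z^{d\times(d-n)}$, $B\in\mathbb Z^{n\times d}$, $A\in\mathbb Z^{d\times n}$ be integer matrices. An integer matrix $M\in\mathbb Z^{p\times q}$ defines homomorphisms of tori $(\mathbb C^*)^q\to(\mathbb C^*)^p$ and $U(1)^q\to U(1)^p$ by $t\mapsto\big(\prod_l t_l^{M_{kl}}\big)_k$; denote those of $Q,B,A$ by $\rho,\beta,\alpha$. Assume that $$1\to(\mathbb C^*)^{d-n}\xrightarrow{\ \rho\ }(\mathbb C^*)^d\xrightarrow{\ \beta\ }(\mathbb C^*)^n\to 1$$ is exact and that $\beta\circ\alpha=\mathrm{id}$. Let $N=U(1)^{d-n}$ act on $\mathbb C^d$, with its standard symplectic form $\omega_0=\frac i2\sum_k dz_k\wedge d\bar z_k$, by $\lambda\cdot z=\rho(\lambda)z$, and let $\mu_N(z)=Q^{T}\big(\tfrac12|z_k|^2\big)_{k}\in\mathbb R^{d-n}$. Let $a\in\mathbb R^{d-n}$ be a regular value of $\mu_N$ such that $N$ acts freely on $\mu_N^{-1}(a)$, and let $M=\mu_N^{-1}(a)/N$ with projection $\pi_a:\mu_N^{-1}(a)\to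 M$ and reduced symplectic form $\omega_a$ (so $\pi_a^*\omega_a=\omega_0|_{\mu_N^{-1}(a)}$). The torus $\mathbb T^n=U(1)^n$ acts on $M$ by $t\cdot\pi_a(z)=\pi_a(\alpha(t)z)$. Let $\kappa\in\mathbb R^d$ with $Q^{T}\kappa=-a$, and let $\mu_a:M\to\mathbb R^n$ be given by $$\mu_a(\pi_a(z))=A^{T}\big(\tfrac12|z_k|^2+\kappa_k\big)_{k}.$$ Let $\Delta=\mu_a(M)$ (the moment polytope), let $v^1,\dots,v^d\in\mathbb Z^n$ be the columns of $B$, put $L(\xi)_j=\langle v^j,\xi\rangle-\kappa_j$ for $\xi\in\mathbb R^n$, and put $\mathcal F_j=\{\xi: L(\xi)_j=0\}\cap\Delta$. A facet of $\Delta$ is a nonempty exposed face of dimension $\dim\Delta-1$. Then: 1. $\mu_a$ is a moment map for the $\mathbb T^n$-action on $(M,\omega_a)$: it is $\mathbb T^n$-invariant and $d\langle\mu_a,\eta\rangle=\omega_a(\cdot,X_\eta)$ for all $\eta\in\mathbb R^n=\mathrm{Lie}(\mathbb T^n)$, where $X_\eta$ is the vector field generated by $\eta$. 2. $\Delta=\{\xi\in\mathbb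 R^n:\ L(\xi)_j=\langle v^j,\xi\rangle-\kappa_j\ge 0\ \text{ for } j=1,\dots,d\}$. 3. The facets of $\Delta$ are exactly the nonempty sets among $\mathcal F_1,\dots,\mathcal F_d$, and distinct indices $j$ with $\mathcal F_j\neq\emptyset$ give distinct facets. Whenever $\mathcal F_j\ne\emptyset$, the vector $v^j$ is a primitive vector of $\mathbb Z^n$ that is an inward-pointing normal to $\mathcal F_j$: $\langle v^j,y-x\rangle=0$ for $x,y\in\mathcal F_j$, and $\langle v^j,y-x\rangle>0$ for $x\in\mathcal F_j$, $y\in\Delta\setminus\mathcal F_j$. 4. In particular, if $\Delta$ has $d$ facets (that is, $d$ is the number of facets of $\Delta$), then $j\mapsto\mathcal F_j$ is a bijection from $\{1,\dots,d\}$ onto the set of facets of $\Delta$, and every $v^j$ is a primitive inward-pointing normal vector to $\mathcal F_j$. -/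

import Mathlib

open scoped Matrix

/-- The homomorphism of tori `G^q → G^p` with integer exponent matrix `M`
(`p × q`): the `k`-th coordinate of the image of `t` is `∏ l, t_l ^ M k l`.  It is used for
`G = ℂˣ` (complex tori) and for `G = Circle` (their maximal compact subgroups); the differential
at the identity is the linear map with matrix `M`. -/
def torusHom (G : Type*) [CommGroup G] {p q : ℕ} (M : Matrix (Fin p) (Fin q) ℤ) :
    (Fin q → G) →* (Fin p → G) where
  toFun t := fun k => ∏ l, t l ^ M k l
  map_one' := by funext k; simp
  map_mul' s t := by funext k; simp [mul_zpow, Finset.prod_mul_distrib]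

/-- The moment map `z ↦ (|z_k|² / 2 + κ_k)_k` of the standard action of `U(1)^d` on `ℂ^d`, with
additive constant `κ`. -/
noncomputable def stdMomentMap {d : ℕ} (κ : Fin d → ℝ) (z : Fin d → ℂ) : Fin d → ℝ :=
  fun k => ‖z k‖ ^ 2 / 2 + κ k

/-- The moment map `μ_N = Qᵀ ∘ (|z_k|² / 2)_k` of the action of `N = U(1)^r` on `ℂ^d` through the
homomorphism with exponent matrix `Q`. -/
noncomputable def muN {d r : ℕ} (Q : Matrix (Fin d) (Fin r) ℤ) (z : Fin d → ℂ) : Fin r → ℝ :=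
  (Q.map (Int.cast : ℤ → ℝ))ᵀ *ᵥ stdMomentMap 0 z

/-- The level set `μ_N⁻¹(a)`. -/
def levelSet {d r : ℕ} (Q : Matrix (Fin d) (Fin r) ℤ) (a : Fin r → ℝ) : Set (Fin d → ℂ) :=
  {z | muN Q z = a}

/-- `a` is a regular value of `μ_N`. -/
def IsRegularValueMuN {d r : ℕ} (Q : Matrix (Fin d) (Fin r) ℤ) (a : Fin r → ℝ) : Prop :=
  ∀ z ∈ levelSet Q a, Function.Surjective (fderiv ℝ (muN Q) z)

theorem stdMomentMap_smul {d : ℕ} (κ : Fin d → ℝ) (t : Fin d → Circle) (z : Fin d → ℂ) :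
    stdMomentMap κ (t • z) = stdMomentMap κ z := by
  funext k
  have h : ‖(t k • z k : ℂ)‖ = ‖z k‖ := by
    rw [Circle.smul_def, norm_smul, Circle.norm_coe, one_mul]
  change ‖(t k • z k : ℂ)‖ ^ 2 / 2 + κ k = ‖z k‖ ^ 2 / 2 + κ k
  rw [h]

/-- The compact torus `U(1)^d` acts on `μ_N⁻¹(a)` by coordinatewise multiplication. -/
instance levelSetMulAction {d r : ℕ} (Q : Matrix (Fin d) (Fin r) ℤ) (a : Fin r → ℝ) :
    MulAction (Fin d → Circle) (levelSet Q a) where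
  smul t z := ⟨t • (z : Fin d → ℂ), by
    have h : muN Q z = a := z.2
    exact (congrArg _ (stdMomentMap_smul 0 t z)).trans h⟩
  one_smul z := Subtype.ext (one_smul (Fin d → Circle) (z : Fin d → ℂ))
  mul_smul s t z := Subtype.ext (mul_smul s t (z : Fin d → ℂ))

/-- `N = U(1)^r` acts freely on `μ_N⁻¹(a)`. -/
def ActsFreely {d r : ℕ} (Q : Matrix (Fin d) (Fin r) ℤ) (a : Fin r → ℝ) : Prop :=
  ∀ (g : Fin r → Circle) (z : levelSet Q a), torusHom Circle Q g • z = z → g = 1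

/-- The reduced space `M = μ_N⁻¹(a) / N`. -/
abbrev ReducedSpace {d r : ℕ} (Q : Matrix (Fin d) (Fin r) ℤ) (a : Fin r → ℝ) : Type :=
  MulAction.orbitRel.Quotient (torusHom Circle Q).range (levelSet Q a)

/-- The projection `π_a : μ_N⁻¹(a) → M`. -/
noncomputable def reducedProj {d r : ℕ} (Q : Matrix (Fin d) (Fin r) ℤ) (a : Fin r → ℝ) (z : levelSet Q a) :
    ReducedSpace Q a :=
  Quotient.mk _ z

/-- The action of `𝕋^n = U(1)^n` on `M` induced by `t · z = α(t) z` on `μ_N⁻¹(a)`, where `α` is the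
homomorphism with exponent matrix `A`. -/
noncomputable def reducedAct {n d r : ℕ} (Q : Matrix (Fin d) (Fin r) ℤ) (A : Matrix (Fin d) (Fin n) ℤ)
    (a : Fin r → ℝ) (t : Fin n → Circle) : ReducedSpace Q a → ReducedSpace Q a :=
  Quotient.map (fun z => torusHom Circle A t • z) (by
    rintro z w ⟨g, rfl⟩
    exact ⟨g, smul_comm (g : Fin d → Circle) (torusHom Circle A t) w⟩)

/-- The map `μ_a : M → ℝ^n` determined by `μ_a (π_a z) = Aᵀ (|z_k|² / 2 + κ_k)_k`. -/
noncomputable def momentMap {n d r : ℕ} (Q : Matrix (Fin d) (Fin r) ℤ)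
    (A : Matrix (Fin d) (Fin n) ℤ) (a : Fin r → ℝ) (κ : Fin d → ℝ) :
    ReducedSpace Q a → Fin n → ℝ :=
  Quotient.lift
    (fun z : levelSet Q a => (A.map (Int.cast : ℤ → ℝ))ᵀ *ᵥ stdMomentMap κ (z : Fin d → ℂ)) (by
      rintro z w ⟨g, rfl⟩
      exact congrArg _ (stdMomentMap_smul κ (g : Fin d → Circle) (w : Fin d → ℂ)))

/-- The standard symplectic form `ω₀ = (i/2) ∑ dz_k ∧ dz̄_k` on `ℂ^d`. -/
noncomputable def stdSymplecticForm {d : ℕ} (u w : Fin d → ℂ) : ℝ :=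
  ∑ k, (starRingEnd ℂ (u k) * w k).im

/-- The vector field on `ℂ^d` generated by `η ∈ Lie(𝕋^n) = ℝ^n` under `t · z = α(t) z`. -/
noncomputable def actionGenerator {n d : ℕ} (A : Matrix (Fin d) (Fin n) ℤ) (η : Fin n → ℝ)
    (z : Fin d → ℂ) : Fin d → ℂ :=
  deriv (fun θ : ℝ => torusHom Circle A (fun m => Circle.exp (θ * η m)) • z) 0

/-- `μ : M → ℝ^n` is a moment map of the `𝕋^n`-action on `(M, ω_a)`, where `ω_a` is the reduced
symplectic form, characterized by `π_a^* ω_a = ι_a^* ω₀`: `μ` is `𝕋^n`-invariant, and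
`d⟨μ, η⟩ = ω_a(·, X_η)` for every `η ∈ ℝ^n`.  As `π_a` is a submersion, the second condition is
expressed on `μ_N⁻¹(a)`, by differentiating `⟨μ ∘ π_a, η⟩` along the curves in `μ_N⁻¹(a)`. -/
structure IsMomentMap {n d r : ℕ} (Q : Matrix (Fin d) (Fin r) ℤ) (A : Matrix (Fin d) (Fin n) ℤ)
    (a : Fin r → ℝ) (μ : ReducedSpace Q a → Fin n → ℝ) : Prop where
  invariant : ∀ (t : Fin n → Circle) (x : ReducedSpace Q a), μ (reducedAct Q A a t x) = μ x
  hamiltonian : ∀ (η : Fin n → ℝ) (γ : ℝ → levelSet Q a) (w : Fin d → ℂ),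
    HasDerivAt (fun s => (γ s : Fin d → ℂ)) w 0 →
      HasDerivAt (fun s => μ (reducedProj Q a (γ s)) ⬝ᵥ η)
        (stdSymplecticForm w (actionGenerator A η (γ 0))) 0

/-- The moment polytope `Δ = μ_a(M)`. -/
noncomputable def momentPolytope {n d r : ℕ} (Q : Matrix (Fin d) (Fin r) ℤ)
    (A : Matrix (Fin d) (Fin n) ℤ) (a : Fin r → ℝ) (κ : Fin d → ℝ) : Set (Fin n → ℝ) :=
  Set.range (momentMap Q A a κ)

/-- The affine map `L(ξ)_j = ⟨v^j, ξ⟩ - κ_j`, where `v^j` is the `j`-th column of `B`. -/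
def affineL {n d : ℕ} (B : Matrix (Fin n) (Fin d) ℤ) (κ : Fin d → ℝ) (ξ : Fin n → ℝ) :
    Fin d → ℝ :=
  fun j => (fun m => (B m j : ℝ)) ⬝ᵥ ξ - κ j

/-- `F` is a facet of the convex set `P`: a nonempty (exposed) face of dimension `dim P - 1`. -/
def IsFacet {n : ℕ} (P F : Set (Fin n → ℝ)) : Prop :=
  IsExposed ℝ P F ∧ F.Nonempty ∧
    Module.finrank ℝ (vectorSpan ℝ F) + 1 = Module.finrank ℝ (vectorSpan ℝ P)

/-- `v` is a primitive vector of the lattice `ℤ^n`. -/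
def IsPrimitiveVector {n : ℕ} (v : Fin n → ℤ) : Prop :=
  ∀ (c : ℤ) (w : Fin n → ℤ), v = c • w → IsUnit c

/-- `v ∈ ℤ^n` is a primitive inward-pointing normal vector to the face `F` of `P`. -/
def IsPrimitiveInwardNormal {n : ℕ} (P F : Set (Fin n → ℝ)) (v : Fin n → ℤ) : Prop :=
  IsPrimitiveVector v ∧
    (∀ x ∈ F, ∀ y ∈ F, (fun m => (v m : ℝ)) ⬝ᵥ (y - x) = 0) ∧
    (∀ x ∈ F, ∀ y ∈ P \ F, 0 < (fun m => (v m : ℝ)) ⬝ᵥ (y - x))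

/-- The set `F_j = {ξ ∈ P | L(ξ)_j = 0}`. -/
def facetSet {n d : ℕ} (B : Matrix (Fin n) (Fin d) ℤ) (κ : Fin d → ℝ) (P : Set (Fin n → ℝ))
    (j : Fin d) : Set (Fin n → ℝ) :=
  {ξ | affineL B κ ξ j = 0} ∩ P

/-!
The exact sequence of complex tori determines everything through two specializations. On
one-parameter subgroups with positive real coordinates, and after taking absolute values of a
preimage, it says that `B A = 1` and `ker B = im Q` over `ℝ`
(`mulVec_mulVec_of_torusHom_comp_eq`, `mulVec_eq_zero_iff_of_torusHom_exact`); for points of `U(1)^d`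
it says that the kernel of `β` on the compact torus is `N` (`exists_torusHom_circle_eq`).

Dually, `Aᵀ` and `Bᵀ` are inverse to each other between `ker Qᵀ` and `ℝ^n`. A point `z` lies in the
level set precisely when `s = (|z_k|² / 2 + κ_k)_k` lies in `ker Qᵀ`, and then `Bᵀ μ_a(π_a z) = s`, that
is, `L(μ_a(π_a z))_j = |z_j|² / 2` (`affineL_momentMap`). So all slacks are nonnegative on `Δ`, and
conversely `z_j = √(2 L(ξ)_j)` is a preimage of any `ξ` with nonnegative slacks. This is the
description of `Δ` as a polyhedron (`momentPolytope_eq`).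

Regularity of `a` at `z` says that `Qᵀ` maps the vectors supported on `{k | z_k ≠ 0}` onto `ℝ^(d-n)`.
Dually, the normals `v^j` of the inequalities active at `π_a z` are linearly independent, so `Δ` is a
simple polyhedron (`isSimplePolyhedron_of_isRegularValueMuN`). In a simple polyhedron any set of
active inequalities can be relaxed to any subset of it by a small displacement. Hence `Δ` has
dimension `n` if it is nonempty, each nonempty `F_j` has dimension `n - 1` and contains a point at
which only the `j`-th inequality is active, and every facet is contained in, so equal to, some `F_j`
(`IsSimplePolyhedron.bijOn_face`).

Freeness of the action gives primitivity: if `v^j = c w` with `c` not a unit, a nontrivial `ζ ∈ U(1)`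
with `ζ^c = 1`, placed in the `j`-th coordinate, is in the kernel of `β`, hence in `N`, and it fixes
every `z` with `z_j = 0` (`isPrimitiveVector_of_actsFreely`). The moment map equation is a direct
computation, since the generating vector field of `η` is `(i (A η)_k z_k)_k`.
-/

/-! ### Simple polyhedra -/

section Polyhedron

variable {n : ℕ} {ι : Type*}

/-- The polyhedron `{ξ | ⟨v_j, ξ⟩ ≥ κ_j for all j}` with inward normals `v_j`. -/
def polyhedron (v : ι → Fin n → ℝ) (κ : ι → ℝ) : Set (Fin n → ℝ) :=
  {ξ | ∀ j, 0 ≤ v j ⬝ᵥ ξ - κ j}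

/-- The face of a polyhedron on which the `j`-th inequality is an equality. -/
def polyhedronFace (v : ι → Fin n → ℝ) (κ : ι → ℝ) (j : ι) : Set (Fin n → ℝ) :=
  {ξ | v j ⬝ᵥ ξ - κ j = 0} ∩ polyhedron v κ

/-- Simplicity of a polyhedron: at each of its points the active normals are linearly independent.
This is encoded dually, by prescribing the values of the active normals on some vector. -/
def IsSimplePolyhedron (v : ι → Fin n → ℝ) (κ : ι → ℝ) : Prop :=
  ∀ ξ ∈ polyhedron v κ, ∀ c : ι → ℝ, ∃ u : Fin n → ℝ,
    ∀ j, v j ⬝ᵥ ξ - κ j = 0 → v j ⬝ᵥ u = c j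

variable {v : ι → Fin n → ℝ} {κ : ι → ℝ}

theorem convex_polyhedron : Convex ℝ (polyhedron v κ) := by
  intro x hx y hy s t hs ht hst j
  have h1 := mul_nonneg hs (hx j)
  have h2 := mul_nonneg ht (hy j)
  have h3 : κ j = s * κ j + t * κ j := by rw [← add_mul, hst, one_mul]
  simp only [dotProduct_add, dotProduct_smul, smul_eq_mul]
  linarith

theorem mem_vectorSpan_of_add_smul_mem {S : Set (Fin n → ℝ)} {x u : Fin n → ℝ} {ε : ℝ}
    (hε : ε ≠ 0) (hx : x ∈ S) (hxu : x + ε • u ∈ S) : u ∈ vectorSpan ℝ S := by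
  have h := vsub_mem_vectorSpan ℝ hxu hx
  rw [vsub_eq_sub, add_sub_cancel_left] at h
  exact (Submodule.smul_mem_iff _ hε).1 h

/-- The linear functional `⟨w, ·⟩`. -/
def dotProductFunctional (w : Fin n → ℝ) : (Fin n → ℝ) →ₗ[ℝ] ℝ :=
  dotProductBilin ℝ ℝ w

@[simp]
theorem dotProductFunctional_apply (w x : Fin n → ℝ) : dotProductFunctional w x = w ⬝ᵥ x := rfl

theorem isExposed_polyhedronFace (j : ι) :
    IsExposed ℝ (polyhedron v κ) (polyhedronFace v κ j) := by
  rintro ⟨ξ, hξj, hξ⟩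
  have hξj' : v j ⬝ᵥ ξ - κ j = 0 := hξj
  refine ⟨-(dotProductFunctional (v j)).toContinuousLinearMap, ?_⟩
  ext x
  constructor
  · rintro ⟨hxj, hx⟩
    have hxj' : v j ⬝ᵥ x - κ j = 0 := hxj
    refine ⟨hx, fun y hy => ?_⟩
    have := hy j
    simp only [neg_apply, LinearMap.coe_toContinuousLinearMap', dotProductFunctional_apply]
    linarith
  · rintro ⟨hx, hmax⟩
    have h1 := hmax ξ hξ
    have h2 := hx j
    simp only [neg_apply, LinearMap.coe_toContinuousLinearMap', dotProductFunctional_apply] at h1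
    refine ⟨?_, hx⟩
    change v j ⬝ᵥ x - κ j = 0
    linarith

variable [Fintype ι]

/-- Inactive inequalities stay strict along a short segment. -/
theorem exists_pos_forall_slack_pos (ξ u : Fin n → ℝ) :
    ∃ ε > (0 : ℝ), ∀ j, 0 < v j ⬝ᵥ ξ - κ j → 0 < v j ⬝ᵥ (ξ + ε • u) - κ j := by
  have h : ∀ᶠ ε : ℝ in nhdsWithin 0 (Set.Ioi 0), ∀ j,
      0 < v j ⬝ᵥ ξ - κ j → 0 < v j ⬝ᵥ (ξ + ε • u) - κ j := by
    rw [Filter.eventually_all]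
    intro j
    by_cases hj : 0 < v j ⬝ᵥ ξ - κ j
    · have hc : Filter.Tendsto (fun ε : ℝ => v j ⬝ᵥ (ξ + ε • u) - κ j) (nhds 0)
          (nhds (v j ⬝ᵥ ξ - κ j)) := by
        have : Continuous fun ε : ℝ => v j ⬝ᵥ (ξ + ε • u) - κ j := by
          simp only [dotProduct_add, dotProduct_smul, smul_eq_mul]
          fun_prop
        simpa using this.tendsto 0
      filter_upwards [nhdsWithin_le_nhds (hc.eventually_const_lt hj)] with ε hε _ using hε
    · exact Filter.Eventually.of_forall fun _ h => absurd h hj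
  obtain ⟨ε, h1, h2⟩ := (h.and self_mem_nhdsWithin).exists
  exact ⟨ε, h2, h1⟩

/-- A simple polyhedron has, near each of its points, a point at which only a prescribed
subset of the active inequalities is still active. -/
theorem IsSimplePolyhedron.exists_active_iff (hs : IsSimplePolyhedron v κ) {ξ : Fin n → ℝ}
    (hξ : ξ ∈ polyhedron v κ) (p : ι → Prop) (hp : ∀ j, p j → v j ⬝ᵥ ξ - κ j = 0) :
    ∃ ξ' ∈ polyhedron v κ, ∀ j, v j ⬝ᵥ ξ' - κ j = 0 ↔ p j := by
  classical
  obtain ⟨u, hu⟩ := hs ξ hξ fun j => if p j then 0 else 1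
  obtain ⟨ε, hε, h⟩ := exists_pos_forall_slack_pos (v := v) (κ := κ) ξ u
  have key : ∀ j, 0 ≤ v j ⬝ᵥ (ξ + ε • u) - κ j ∧ (v j ⬝ᵥ (ξ + ε • u) - κ j = 0 ↔ p j) := by
    intro j
    rcases (hξ j).eq_or_lt with h0 | h0
    · have hj := hu j h0.symm
      have he : v j ⬝ᵥ (ξ + ε • u) - κ j = ε * v j ⬝ᵥ u := by
        rw [dotProduct_add, dotProduct_smul, smul_eq_mul]; linarith
      rw [he, hj]
      split_ifs with hpj
      · simp [hpj]
      · simp [hpj, hε.le, hε.ne']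
    · have hj := h j h0
      exact ⟨hj.le, fun h' => absurd h' hj.ne', fun h' => absurd (hp j h') h0.ne'⟩
  exact ⟨ξ + ε • u, fun j => (key j).1, fun j => (key j).2⟩

theorem exists_pos_add_smul_mem_polyhedron {ξ : Fin n → ℝ} (hξ : ∀ j, 0 < v j ⬝ᵥ ξ - κ j)
    (u : Fin n → ℝ) : ∃ ε > (0 : ℝ), ξ + ε • u ∈ polyhedron v κ := by
  obtain ⟨ε, hε, h⟩ := exists_pos_forall_slack_pos (v := v) (κ := κ) ξ u
  exact ⟨ε, hε, fun j => (h j (hξ j)).le⟩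

theorem IsSimplePolyhedron.vectorSpan_eq_top (hs : IsSimplePolyhedron v κ)
    (hne : (polyhedron v κ).Nonempty) : vectorSpan ℝ (polyhedron v κ) = ⊤ := by
  obtain ⟨ξ, hξ⟩ := hne
  obtain ⟨x, hx, hact⟩ := hs.exists_active_iff hξ (fun _ => False) (by simp)
  refine eq_top_iff.2 fun u _ => ?_
  obtain ⟨ε, hε, hu⟩ := exists_pos_add_smul_mem_polyhedron
    (fun j => (hx j).lt_of_ne fun h => (hact j).1 h.symm) u
  exact mem_vectorSpan_of_add_smul_mem hε.ne' hx hu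

theorem IsSimplePolyhedron.vectorSpan_face (hs : IsSimplePolyhedron v κ) {j : ι}
    (hne : (polyhedronFace v κ j).Nonempty) :
    vectorSpan ℝ (polyhedronFace v κ j) = LinearMap.ker (dotProductFunctional (v j)) := by
  obtain ⟨ξ, hξj, hξ⟩ := hne
  refine le_antisymm ?_ fun u hu => ?_
  · rw [vectorSpan_def, Submodule.span_le]
    rintro _ ⟨x, hx, y, hy, rfl⟩
    have h1 : v j ⬝ᵥ x - κ j = 0 := hx.1
    have h2 : v j ⬝ᵥ y - κ j = 0 := hy.1
    simp only [vsub_eq_sub, SetLike.mem_coe, LinearMap.mem_ker, dotProductFunctional_apply,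
      dotProduct_sub]
    linarith
  · obtain ⟨x, hx, hact⟩ := hs.exists_active_iff hξ (fun i => i = j) (by rintro _ rfl; exact hξj)
    obtain ⟨ε, hε, h⟩ := exists_pos_forall_slack_pos (v := v) (κ := κ) x u
    have hu' : v j ⬝ᵥ u = 0 := hu
    have hxj : v j ⬝ᵥ x - κ j = 0 := (hact j).2 rfl
    have hxuj : v j ⬝ᵥ (x + ε • u) - κ j = 0 := by
      rw [dotProduct_add, dotProduct_smul, hu', smul_zero, add_zero, hxj]
    refine mem_vectorSpan_of_add_smul_mem hε.ne' ⟨hxj, hx⟩ ⟨hxuj, fun i => ?_⟩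
    by_cases hi : i = j
    · subst hi; exact hxuj.ge
    · exact (h i ((hx i).lt_of_ne fun h' => hi ((hact i).1 h'.symm))).le

theorem IsSimplePolyhedron.finrank_vectorSpan_face (hs : IsSimplePolyhedron v κ) {j : ι}
    (hne : (polyhedronFace v κ j).Nonempty) :
    Module.finrank ℝ (vectorSpan ℝ (polyhedronFace v κ j)) + 1 = n := by
  rw [hs.vectorSpan_face hne]
  obtain ⟨ξ, hξj, hξ⟩ := hne
  obtain ⟨u, hu⟩ := hs ξ hξ 1
  have hsurj : LinearMap.range (dotProductFunctional (v j)) = ⊤ := by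
    rw [LinearMap.range_eq_top]
    intro r
    exact ⟨r • u, by simp [hu j hξj]⟩
  have h := LinearMap.finrank_range_add_finrank_ker (dotProductFunctional (v j))
  rw [hsurj, finrank_top, Module.finrank_self, Module.finrank_fin_fun] at h
  omega

theorem IsSimplePolyhedron.isFacet_face (hs : IsSimplePolyhedron v κ) {j : ι}
    (hne : (polyhedronFace v κ j).Nonempty) : IsFacet (polyhedron v κ) (polyhedronFace v κ j) := by
  refine ⟨isExposed_polyhedronFace j, hne, ?_⟩
  rw [hs.finrank_vectorSpan_face hne, hs.vectorSpan_eq_top (hne.mono Set.inter_subset_right),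
    finrank_top, Module.finrank_fin_fun]

theorem IsSimplePolyhedron.injOn_face (hs : IsSimplePolyhedron v κ) :
    Set.InjOn (polyhedronFace v κ) {j | (polyhedronFace v κ j).Nonempty} := by
  rintro i ⟨ξ, hξi, hξ⟩ j _ hij
  obtain ⟨x, hx, hact⟩ := hs.exists_active_iff hξ (fun k => k = i) (by rintro _ rfl; exact hξi)
  have hxi : x ∈ polyhedronFace v κ i := ⟨(hact i).2 rfl, hx⟩
  rw [hij] at hxi
  exact ((hact j).1 hxi.1).symm

/-- A nonempty convex subset of a polyhedron lies in a face of the polyhedron given by one of the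
inequalities, or contains a point without active inequalities. -/
theorem exists_subset_face_or_exists_slack_pos {F : Set (Fin n → ℝ)} (hF : Convex ℝ F)
    (hFne : F.Nonempty) (hFP : F ⊆ polyhedron v κ) :
    (∃ j, F ⊆ polyhedronFace v κ j) ∨ ∃ x ∈ F, ∀ j, 0 < v j ⬝ᵥ x - κ j := by
  classical
  -- A point of `F` with the fewest active inequalities.
  obtain ⟨x, hxF, hmin⟩ : ∃ x ∈ F, ∀ y ∈ F,
      (Finset.univ.filter fun j => v j ⬝ᵥ x - κ j = 0).card ≤
        (Finset.univ.filter fun j => v j ⬝ᵥ y - κ j = 0).card :=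
    let f : (Fin n → ℝ) → ℕ := fun x => (Finset.univ.filter fun j => v j ⬝ᵥ x - κ j = 0).card
    ⟨_, Function.argminOn_mem f F hFne, fun y hy => Function.argminOn_le f F hy⟩
  by_cases hpos : ∀ j, 0 < v j ⬝ᵥ x - κ j
  · exact .inr ⟨x, hxF, hpos⟩
  push Not at hpos
  obtain ⟨j, hj⟩ := hpos
  have hxj : v j ⬝ᵥ x - κ j = 0 := le_antisymm hj (hFP hxF j)
  refine .inl ⟨j, fun y hy => ⟨?_, hFP hy⟩⟩
  by_contra hyj
  have hyj' : 0 < v j ⬝ᵥ y - κ j := (hFP hy j).lt_of_ne (Ne.symm hyj)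
  -- The midpoint of `x` and `y` has fewer active inequalities than `x`.
  have hm : (1 / 2 : ℝ) • x + (1 / 2 : ℝ) • y ∈ F :=
    hF hxF hy (by norm_num) (by norm_num) (by norm_num)
  have hmid : ∀ i, v i ⬝ᵥ ((1 / 2 : ℝ) • x + (1 / 2 : ℝ) • y) - κ i =
      ((v i ⬝ᵥ x - κ i) + (v i ⬝ᵥ y - κ i)) / 2 := by
    intro i
    simp only [dotProduct_add, dotProduct_smul, smul_eq_mul]
    ring
  refine (hmin _ hm).not_gt (Finset.card_lt_card ?_)
  refine (Finset.ssubset_iff_of_subset fun i hi => ?_).2 ⟨j, by simpa using hxj, ?_⟩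
  · have h1 := (Finset.mem_filter.1 hi).2
    rw [hmid] at h1
    have h2 := hFP hxF i
    have h3 := hFP hy i
    exact Finset.mem_filter.2 ⟨Finset.mem_univ _, by linarith⟩
  · intro hj'
    have h1 := (Finset.mem_filter.1 hj').2
    rw [hmid] at h1
    linarith

theorem IsSimplePolyhedron.exists_face_eq_of_isFacet (hs : IsSimplePolyhedron v κ)
    {F : Set (Fin n → ℝ)} (hF : IsFacet (polyhedron v κ) F) :
    ∃ j, (polyhedronFace v κ j).Nonempty ∧ polyhedronFace v κ j = F := by
  obtain ⟨hexp, hFne, hdim⟩ := hF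
  have hFP : F ⊆ polyhedron v κ := hexp.subset
  have htop := hs.vectorSpan_eq_top (hFne.mono hFP)
  obtain ⟨l, hl⟩ := hexp hFne
  have hmax : ∀ x ∈ F, ∀ y ∈ polyhedron v κ, l y ≤ l x := by
    intro x hx
    rw [hl] at hx
    exact hx.2
  rcases exists_subset_face_or_exists_slack_pos (hexp.convex convex_polyhedron) hFne hFP with
    ⟨j, hj⟩ | ⟨x, hxF, hx⟩
  · have hne := hFne.mono hj
    refine ⟨j, hne, Set.Subset.antisymm (fun y hy => ?_) hj⟩
    have hspan : vectorSpan ℝ F = vectorSpan ℝ (polyhedronFace v κ j) := by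
      refine Submodule.eq_of_le_of_finrank_eq (vectorSpan_mono ℝ hj) ?_
      have h1 := hs.finrank_vectorSpan_face hne
      rw [htop, finrank_top, Module.finrank_fin_fun] at hdim
      omega
    -- `l` is constant on `F`, hence vanishes on the direction of the face.
    have hker : vectorSpan ℝ F ≤ LinearMap.ker (l : (Fin n → ℝ) →ₗ[ℝ] ℝ) := by
      rw [vectorSpan_def, Submodule.span_le]
      rintro _ ⟨x, hx, z, hz, rfl⟩
      have h1 := hmax x hx z (hFP hz)
      have h2 := hmax z hz x (hFP hx)
      simp only [vsub_eq_sub, SetLike.mem_coe, LinearMap.mem_ker, ContinuousLinearMap.coe_coe,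
        map_sub]
      linarith
    obtain ⟨x, hx⟩ := hFne
    have hyx : l (y - x) = 0 := by
      have h := vsub_mem_vectorSpan ℝ hy (hj hx)
      rw [← hspan] at h
      exact hker h
    rw [map_sub] at hyx
    rw [hl]
    refine ⟨hy.2, fun z hz => ?_⟩
    have := hmax x hx z hz
    linarith
  · -- `l` is maximal at an interior point, so it vanishes and `F` is the whole polyhedron.
    exfalso
    have hl0 : ∀ u, l u ≤ 0 := by
      intro u
      obtain ⟨ε, hε, hu⟩ := exists_pos_add_smul_mem_polyhedron hx u
      have h := hmax x hxF _ hu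
      rw [map_add, map_smul, smul_eq_mul] at h
      nlinarith
    have hl0' : ∀ u, l u = 0 := by
      intro u
      have h := hl0 (-u)
      rw [map_neg] at h
      linarith [hl0 u]
    have hFeq : F = polyhedron v κ := by
      rw [hl]
      ext y
      simp [hl0']
    rw [hFeq] at hdim
    omega

theorem IsSimplePolyhedron.bijOn_face (hs : IsSimplePolyhedron v κ) :
    Set.BijOn (polyhedronFace v κ) {j | (polyhedronFace v κ j).Nonempty}
      {F | IsFacet (polyhedron v κ) F} :=
  ⟨fun _ hj => hs.isFacet_face hj, hs.injOn_face, fun _ hF => hs.exists_face_eq_of_isFacet hF⟩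

end Polyhedron

/-! ### Homomorphisms of tori and their exponent matrices -/

section Torus

variable {p q : ℕ}

theorem torusHom_apply {G : Type*} [CommGroup G] (M : Matrix (Fin p) (Fin q) ℤ) (t : Fin q → G)
    (k : Fin p) : torusHom G M t k = ∏ l, t l ^ M k l := rfl

theorem torusHom_map {G H : Type*} [CommGroup G] [CommGroup H] (f : G →* H)
    (M : Matrix (Fin p) (Fin q) ℤ) (t : Fin q → G) :
    torusHom H M (fun l => f (t l)) = fun k => f (torusHom G M t k) := by
  funext k
  simp [torusHom_apply, map_prod, map_zpow]

/-- One-parameter subgroups turn `torusHom` into multiplication by the exponent matrix. -/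
theorem torusHom_addChar {G : Type*} [CommGroup G] (e : AddChar ℝ G)
    (M : Matrix (Fin p) (Fin q) ℤ) (x : Fin q → ℝ) :
    torusHom G M (fun l => e (x l)) = fun k => e ((M.map (Int.cast : ℤ → ℝ) *ᵥ x) k) := by
  funext k
  have h := map_prod e.toMonoidHom
    (fun l => Multiplicative.ofAdd (M.map (Int.cast : ℤ → ℝ) k l * x l)) Finset.univ
  rw [← ofAdd_sum] at h
  rw [torusHom_apply]
  refine Eq.trans (Finset.prod_congr rfl fun l _ => ?_) h.symm
  exact (AddChar.map_zsmul_eq_zpow e (M k l) (x l)).symm.trans (by rw [zsmul_eq_mul]; rfl)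

theorem torusHom_mulSingle {G : Type*} [CommGroup G] (M : Matrix (Fin p) (Fin q) ℤ) (j : Fin q)
    (z : G) (k : Fin p) : torusHom G M (Pi.mulSingle j z) k = z ^ M k j := by
  rw [torusHom_apply, Finset.prod_eq_single j]
  · simp
  · intro l _ hl
    simp [Pi.mulSingle_eq_of_ne hl]
  · simp

/-- The real exponential as a one-parameter subgroup of `ℂˣ`. -/
noncomputable def realExpChar : AddChar ℝ ℂˣ where
  toFun x := Units.mk0 (Real.exp x : ℂ) (by exact_mod_cast (Real.exp_pos x).ne')
  map_zero_eq_one' := by ext; simp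
  map_add_eq_mul' x y := by ext; simp [Complex.exp_add]

theorem coe_realExpChar (x : ℝ) : (realExpChar x : ℂ) = (Real.exp x : ℝ) := rfl

theorem realExpChar_injective : Function.Injective realExpChar := by
  intro x y h
  have h' := congrArg (fun u : ℂˣ => (u : ℂ)) h
  simp only [coe_realExpChar] at h'
  exact Real.exp_injective (by exact_mod_cast h')

/-- The one-parameter subgroup `θ ↦ e^{iθ}` of `U(1)`. -/
noncomputable def circleExpChar : AddChar ℝ Circle where
  toFun x := Circle.exp x
  map_zero_eq_one' := Circle.exp_zero
  map_add_eq_mul' x y := Circle.exp_add x y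

/-- The retraction `u ↦ |u|` of `ℂˣ` onto its subgroup of positive reals. -/
noncomputable def unitsAbs : ℂˣ →* ℂˣ :=
  Units.map ((Complex.ofRealHom : ℝ →* ℂ).comp (normHom : ℂ →*₀ ℝ).toMonoidHom)

theorem coe_unitsAbs (u : ℂˣ) : (unitsAbs u : ℂ) = (‖(u : ℂ)‖ : ℝ) := rfl

theorem unitsAbs_realExpChar (x : ℝ) : unitsAbs (realExpChar x) = realExpChar x := by
  ext
  rw [coe_unitsAbs, coe_realExpChar, Complex.norm_real, Real.norm_of_nonneg (Real.exp_pos x).le]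

theorem unitsAbs_toUnits (z : Circle) : unitsAbs (Circle.toUnits z) = 1 := by
  ext
  rw [coe_unitsAbs, Circle.toUnits_apply, Units.val_mk0, Circle.norm_coe]
  simp

theorem exists_realExpChar_eq_unitsAbs (u : ℂˣ) : ∃ x, realExpChar x = unitsAbs u :=
  ⟨Real.log ‖(u : ℂ)‖, by
    ext
    rw [coe_unitsAbs, coe_realExpChar, Real.exp_log (norm_pos_iff.2 u.ne_zero)]⟩

theorem exists_toUnits_eq_of_unitsAbs_eq_one {u : ℂˣ} (h : unitsAbs u = 1) :
    ∃ z : Circle, Circle.toUnits z = u := by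
  have h' := congrArg (fun u : ℂˣ => (u : ℂ)) h
  simp only [coe_unitsAbs, Units.val_one] at h'
  have h1 : ‖(u : ℂ)‖ = 1 := by exact_mod_cast h'
  exact ⟨⟨u, mem_sphere_zero_iff_norm.2 h1⟩, by ext; rfl⟩

theorem toUnits_injective : Function.Injective Circle.toUnits := by
  intro z w h
  exact Circle.ext (congrArg (fun u : ℂˣ => (u : ℂ)) h)

variable {n d r : ℕ} {Q : Matrix (Fin d) (Fin r) ℤ} {B : Matrix (Fin n) (Fin d) ℤ}
  {A : Matrix (Fin d) (Fin n) ℤ}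

/-- The Lie algebra version of `β ∘ α = id`. -/
theorem mulVec_mulVec_of_torusHom_comp_eq
    (hα : ∀ t : Fin n → ℂˣ, torusHom ℂˣ B (torusHom ℂˣ A t) = t) (x : Fin n → ℝ) :
    B.map (Int.cast : ℤ → ℝ) *ᵥ (A.map (Int.cast : ℤ → ℝ) *ᵥ x) = x := by
  have h := hα fun l => realExpChar (x l)
  rw [torusHom_addChar, torusHom_addChar] at h
  exact funext fun k => realExpChar_injective (congrFun h k)

/-- The Lie algebra version of exactness in the middle: taking absolute values shows that an
element of `ker β` with positive coordinates comes from one with positive coordinates. -/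
theorem mulVec_eq_zero_iff_of_torusHom_exact
    (hexact : (torusHom ℂˣ Q).range = (torusHom ℂˣ B).ker) (x : Fin d → ℝ) :
    B.map (Int.cast : ℤ → ℝ) *ᵥ x = 0 ↔ ∃ y, Q.map (Int.cast : ℤ → ℝ) *ᵥ y = x := by
  have hker : B.map (Int.cast : ℤ → ℝ) *ᵥ x = 0 ↔
      (fun l => realExpChar (x l)) ∈ (torusHom ℂˣ Q).range := by
    rw [hexact, MonoidHom.mem_ker, torusHom_addChar]
    refine ⟨fun h => ?_, fun h => ?_⟩
    · funext k
      rw [h, Pi.zero_apply, AddChar.map_zero_eq_one, Pi.one_apply]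
    · funext k
      refine realExpChar_injective ?_
      rw [Pi.zero_apply, AddChar.map_zero_eq_one]
      exact congrFun h k
  rw [hker]
  constructor
  · rintro ⟨t, ht⟩
    choose y hy using fun l => exists_realExpChar_eq_unitsAbs (t l)
    refine ⟨y, funext fun k => realExpChar_injective ?_⟩
    have h := congrFun (torusHom_addChar realExpChar Q y) k
    simp only [hy] at h
    rw [← h, torusHom_map, ht]
    exact unitsAbs_realExpChar _
  · rintro ⟨y, rfl⟩
    exact ⟨_, torusHom_addChar realExpChar Q y⟩

/-- Exactness in the middle passes to the compact tori: by injectivity of `ρ`, a preimage of an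
element of `U(1)^d` has coordinates of absolute value `1`. -/
theorem exists_torusHom_circle_eq (hρ : Function.Injective (torusHom ℂˣ Q))
    (hexact : (torusHom ℂˣ Q).range = (torusHom ℂˣ B).ker) {t : Fin d → Circle}
    (ht : torusHom Circle B t = 1) : ∃ g, torusHom Circle Q g = t := by
  have hmem : (fun k => Circle.toUnits (t k)) ∈ (torusHom ℂˣ Q).range := by
    rw [hexact, MonoidHom.mem_ker, torusHom_map, ht]
    funext k
    exact map_one _
  obtain ⟨s, hs⟩ := hmem
  have habs : (fun l => unitsAbs (s l)) = 1 := by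
    apply hρ
    rw [torusHom_map, hs, map_one]
    exact funext fun k => unitsAbs_toUnits _
  choose g hg using fun l => exists_toUnits_eq_of_unitsAbs_eq_one (congrFun habs l)
  refine ⟨g, funext fun k => toUnits_injective ?_⟩
  have h := congrFun (torusHom_map Circle.toUnits Q g) k
  simp only [hg] at h
  rw [← h]
  exact congrFun hs k

/-- The transpose of `A` inverts that of `B` on the annihilator of the image of `Q`. -/
theorem transpose_mulVec_transpose_mulVec
    (hexact : (torusHom ℂˣ Q).range = (torusHom ℂˣ B).ker)
    (hα : ∀ t : Fin n → ℂˣ, torusHom ℂˣ B (torusHom ℂˣ A t) = t) {s : Fin d → ℝ}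
    (hs : (Q.map (Int.cast : ℤ → ℝ))ᵀ *ᵥ s = 0) :
    (B.map (Int.cast : ℤ → ℝ))ᵀ *ᵥ ((A.map (Int.cast : ℤ → ℝ))ᵀ *ᵥ s) = s := by
  refine dotProduct_eq _ _ fun x => ?_
  rw [Matrix.mulVec_transpose, Matrix.mulVec_transpose, ← Matrix.dotProduct_mulVec,
    ← Matrix.dotProduct_mulVec]
  -- `x - A B x` lies in the kernel of `B`, hence in the image of `Q`.
  obtain ⟨y, hy⟩ := (mulVec_eq_zero_iff_of_torusHom_exact hexact
    (x - A.map (Int.cast : ℤ → ℝ) *ᵥ (B.map (Int.cast : ℤ → ℝ) *ᵥ x))).1 (by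
      rw [Matrix.mulVec_sub, mulVec_mulVec_of_torusHom_comp_eq hα, sub_self])
  have h : s ⬝ᵥ (x - A.map (Int.cast : ℤ → ℝ) *ᵥ (B.map (Int.cast : ℤ → ℝ) *ᵥ x)) = 0 := by
    rw [← hy, Matrix.dotProduct_mulVec, ← Matrix.mulVec_transpose, hs, zero_dotProduct]
  rw [dotProduct_sub] at h
  linarith

theorem transpose_mulVec_right_inverse
    (hα : ∀ t : Fin n → ℂˣ, torusHom ℂˣ B (torusHom ℂˣ A t) = t) (ξ : Fin n → ℝ) :
    (A.map (Int.cast : ℤ → ℝ))ᵀ *ᵥ ((B.map (Int.cast : ℤ → ℝ))ᵀ *ᵥ ξ) = ξ := by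
  refine dotProduct_eq _ _ fun x => ?_
  rw [Matrix.mulVec_transpose, Matrix.mulVec_transpose, ← Matrix.dotProduct_mulVec,
    ← Matrix.dotProduct_mulVec, mulVec_mulVec_of_torusHom_comp_eq hα]

theorem transpose_mulVec_transpose_mulVec_eq_zero
    (hexact : (torusHom ℂˣ Q).range = (torusHom ℂˣ B).ker) (ξ : Fin n → ℝ) :
    (Q.map (Int.cast : ℤ → ℝ))ᵀ *ᵥ ((B.map (Int.cast : ℤ → ℝ))ᵀ *ᵥ ξ) = 0 := by
  refine dotProduct_eq _ _ fun x => ?_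
  rw [Matrix.mulVec_transpose, Matrix.mulVec_transpose, ← Matrix.dotProduct_mulVec,
    ← Matrix.dotProduct_mulVec, (mulVec_eq_zero_iff_of_torusHom_exact hexact _).2 ⟨x, rfl⟩,
    dotProduct_zero, zero_dotProduct]

end Torus

/-! ### The moment maps -/

section MomentMap

variable {n d r : ℕ} {Q : Matrix (Fin d) (Fin r) ℤ} {B : Matrix (Fin n) (Fin d) ℤ}
  {A : Matrix (Fin d) (Fin n) ℤ} {a : Fin r → ℝ} {κ : Fin d → ℝ}

theorem hasDerivAt_stdMomentMap (κ : Fin d → ℝ) {γ : ℝ → Fin d → ℂ} {w : Fin d → ℂ} {s : ℝ}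
    (h : HasDerivAt γ w s) :
    HasDerivAt (fun s => stdMomentMap κ (γ s)) (fun k => (starRingEnd ℂ (γ s k) * w k).re) s := by
  refine hasDerivAt_pi.2 fun k => ?_
  have h1 := ((hasDerivAt_pi.1 h k).norm_sq.div_const 2).add_const (κ k)
  refine h1.congr_deriv ?_
  rw [mul_div_cancel_left₀ _ two_ne_zero, Complex.inner, mul_comm]

theorem HasDerivAt.matrix_mulVec {p q : ℕ} (M : Matrix (Fin p) (Fin q) ℝ) {f : ℝ → Fin q → ℝ}
    {f' : Fin q → ℝ} {s : ℝ} (h : HasDerivAt f f' s) :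
    HasDerivAt (fun s => M *ᵥ f s) (M *ᵥ f') s :=
  M.mulVecLin.toContinuousLinearMap.hasFDerivAt.comp_hasDerivAt s h

theorem differentiable_muN : Differentiable ℝ (muN Q) := by
  have h : Differentiable ℝ (stdMomentMap (0 : Fin d → ℝ)) := by
    refine differentiable_pi.2 fun k => ?_
    have hk : Differentiable ℝ fun z : Fin d → ℂ => z k := differentiable_apply k
    have hk2 : Differentiable ℝ fun z : Fin d → ℂ => ‖z k‖ ^ 2 := hk.norm_sq ℝ
    simp only [stdMomentMap, div_eq_mul_inv]
    exact (hk2.mul_const (2 : ℝ)⁻¹).add_const _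
  exact (Matrix.mulVecLin (Q.map (Int.cast : ℤ → ℝ))ᵀ).toContinuousLinearMap.differentiable.comp h

theorem fderiv_muN_apply (z w : Fin d → ℂ) :
    fderiv ℝ (muN Q) z w =
      (Q.map (Int.cast : ℤ → ℝ))ᵀ *ᵥ fun k => (starRingEnd ℂ (z k) * w k).re := by
  have hγ : HasDerivAt (fun s : ℝ => z + s • w) w 0 := by
    simpa using ((hasDerivAt_id (0 : ℝ)).smul_const w).const_add z
  have h1 := (hasDerivAt_stdMomentMap 0 hγ).matrix_mulVec (Q.map (Int.cast : ℤ → ℝ))ᵀ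
  have h2 := HasFDerivAt.comp_hasDerivAt (0 : ℝ)
    (differentiable_muN (Q := Q) (z + (0 : ℝ) • w)).hasFDerivAt hγ
  simp only [zero_smul, add_zero] at h1 h2
  exact h2.unique h1

theorem actionGenerator_apply (A : Matrix (Fin d) (Fin n) ℤ) (η : Fin n → ℝ) (z : Fin d → ℂ)
    (k : Fin d) :
    actionGenerator A η z k = ((A.map (Int.cast : ℤ → ℝ) *ᵥ η) k : ℂ) * Complex.I * z k := by
  set x := A.map (Int.cast : ℤ → ℝ) *ᵥ η with hx
  have hcurve : (fun θ : ℝ => torusHom Circle A (fun m => Circle.exp (θ * η m)) • z) =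
      fun θ k => Complex.exp ((θ * x k : ℝ) * Complex.I) * z k := by
    funext θ k
    have h := congrFun (torusHom_addChar circleExpChar A (θ • η)) k
    rw [Matrix.mulVec_smul, ← hx] at h
    change torusHom Circle A (fun m => Circle.exp (θ * η m)) k • z k = _
    have h' : torusHom Circle A (fun m => Circle.exp (θ * η m)) k = Circle.exp (θ * x k) := h
    rw [h', Circle.smul_def, Circle.coe_exp, smul_eq_mul]
  have hderiv : HasDerivAt (fun (θ : ℝ) k => Complex.exp ((θ * x k : ℝ) * Complex.I) * z k)
      (fun k => (x k : ℂ) * Complex.I * z k) 0 := by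
    refine hasDerivAt_pi.2 fun k => ?_
    have h1 : HasDerivAt (fun θ : ℝ => ((θ * x k : ℝ) : ℂ) * Complex.I)
        (((1 * x k : ℝ) : ℂ) * Complex.I) 0 :=
      ((hasDerivAt_id (0 : ℝ)).mul_const (x k)).ofReal_comp.mul_const Complex.I
    simpa using h1.cexp.mul_const (z k)
  rw [actionGenerator, hcurve, hderiv.deriv]

theorem stdSymplecticForm_actionGenerator (A : Matrix (Fin d) (Fin n) ℤ) (η : Fin n → ℝ)
    (z w : Fin d → ℂ) :
    stdSymplecticForm w (actionGenerator A η z) =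
      ((A.map (Int.cast : ℤ → ℝ))ᵀ *ᵥ fun k => (starRingEnd ℂ (z k) * w k).re) ⬝ᵥ η := by
  rw [Matrix.mulVec_transpose, ← Matrix.dotProduct_mulVec]
  refine Finset.sum_congr rfl fun k _ => ?_
  rw [actionGenerator_apply]
  simp only [Complex.mul_im, Complex.mul_re, Complex.conj_re, Complex.conj_im, Complex.ofReal_re,
    Complex.ofReal_im, Complex.I_re, Complex.I_im]
  ring

theorem momentMap_reducedProj (z : levelSet Q a) :
    momentMap Q A a κ (reducedProj Q a z) =
      (A.map (Int.cast : ℤ → ℝ))ᵀ *ᵥ stdMomentMap κ (z : Fin d → ℂ) := rfl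

theorem isMomentMap_momentMap : IsMomentMap Q A a (momentMap Q A a κ) where
  invariant t x := by
    obtain ⟨z, rfl⟩ := Quotient.exists_rep x
    exact congrArg ((A.map (Int.cast : ℤ → ℝ))ᵀ *ᵥ ·)
      (stdMomentMap_smul κ (torusHom Circle A t) (z : Fin d → ℂ))
  hamiltonian η γ w hγ := by
    have h1 := (hasDerivAt_stdMomentMap κ hγ).matrix_mulVec (A.map (Int.cast : ℤ → ℝ))ᵀ
    have h2 : HasDerivAt (fun s => momentMap Q A a κ (reducedProj Q a (γ s)) ⬝ᵥ η)
        (((A.map (Int.cast : ℤ → ℝ))ᵀ *ᵥ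
          fun k => (starRingEnd ℂ ((γ 0 : Fin d → ℂ) k) * w k).re) ⬝ᵥ η) 0 :=
      HasDerivAt.fun_sum fun m _ => (hasDerivAt_pi.1 h1 m).mul_const (η m)
    rwa [stdSymplecticForm_actionGenerator]

/-! ### The moment polytope -/

theorem mem_levelSet_iff (hκ : (Q.map (Int.cast : ℤ → ℝ))ᵀ *ᵥ κ = -a) {z : Fin d → ℂ} :
    z ∈ levelSet Q a ↔ (Q.map (Int.cast : ℤ → ℝ))ᵀ *ᵥ stdMomentMap κ z = 0 := by
  have h : stdMomentMap κ z = stdMomentMap 0 z + κ := by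
    funext k
    simp [stdMomentMap]
  rw [h, Matrix.mulVec_add, hκ, ← sub_eq_add_neg, sub_eq_zero]
  rfl

theorem transpose_mulVec_apply (B : Matrix (Fin n) (Fin d) ℤ) (ξ : Fin n → ℝ) (j : Fin d) :
    ((B.map (Int.cast : ℤ → ℝ))ᵀ *ᵥ ξ) j = (fun m => (B m j : ℝ)) ⬝ᵥ ξ := rfl

/-- The slack of the `j`-th inequality at `μ_a (π_a z)` is `|z_j|² / 2`. -/
theorem affineL_momentMap (hexact : (torusHom ℂˣ Q).range = (torusHom ℂˣ B).ker)
    (hα : ∀ t : Fin n → ℂˣ, torusHom ℂˣ B (torusHom ℂˣ A t) = t)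
    (hκ : (Q.map (Int.cast : ℤ → ℝ))ᵀ *ᵥ κ = -a) (z : levelSet Q a) (j : Fin d) :
    affineL B κ (momentMap Q A a κ (reducedProj Q a z)) j = ‖(z : Fin d → ℂ) j‖ ^ 2 / 2 := by
  rw [affineL, ← transpose_mulVec_apply, momentMap_reducedProj,
    transpose_mulVec_transpose_mulVec hexact hα ((mem_levelSet_iff hκ).1 z.2), stdMomentMap,
    add_sub_cancel_right]

/-- A point with nonnegative slacks `L_j` is the image of `(√(2 L_j))_j`. -/
theorem exists_momentMap_eq (hexact : (torusHom ℂˣ Q).range = (torusHom ℂˣ B).ker)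
    (hα : ∀ t : Fin n → ℂˣ, torusHom ℂˣ B (torusHom ℂˣ A t) = t)
    (hκ : (Q.map (Int.cast : ℤ → ℝ))ᵀ *ᵥ κ = -a) {ξ : Fin n → ℝ}
    (hξ : ∀ j, 0 ≤ affineL B κ ξ j) :
    ∃ z : levelSet Q a, momentMap Q A a κ (reducedProj Q a z) = ξ := by
  have hs : stdMomentMap κ (fun j => (√(2 * affineL B κ ξ j) : ℂ)) =
      (B.map (Int.cast : ℤ → ℝ))ᵀ *ᵥ ξ := by
    funext j
    have h2 : 0 ≤ 2 * affineL B κ ξ j := mul_nonneg zero_le_two (hξ j)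
    rw [stdMomentMap, Complex.norm_real, Real.norm_of_nonneg (Real.sqrt_nonneg _),
      Real.sq_sqrt h2, transpose_mulVec_apply, affineL]
    ring
  refine ⟨⟨fun j => (√(2 * affineL B κ ξ j) : ℂ), (mem_levelSet_iff hκ).2 ?_⟩, ?_⟩
  · rw [hs, transpose_mulVec_transpose_mulVec_eq_zero hexact]
  · rw [momentMap_reducedProj, hs, transpose_mulVec_right_inverse hα]

theorem momentPolytope_eq (hexact : (torusHom ℂˣ Q).range = (torusHom ℂˣ B).ker)
    (hα : ∀ t : Fin n → ℂˣ, torusHom ℂˣ B (torusHom ℂˣ A t) = t)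
    (hκ : (Q.map (Int.cast : ℤ → ℝ))ᵀ *ᵥ κ = -a) :
    momentPolytope Q A a κ = {ξ | ∀ j, 0 ≤ affineL B κ ξ j} := by
  ext ξ
  constructor
  · rintro ⟨x, rfl⟩ j
    obtain ⟨z, rfl⟩ := Quotient.exists_rep x
    exact (affineL_momentMap hexact hα hκ z j).symm ▸ by positivity
  · intro hξ
    obtain ⟨z, hz⟩ := exists_momentMap_eq hexact hα hκ hξ
    exact ⟨_, hz⟩

/-- Regularity of the level `a` is simplicity of the polytope: the image of `dμ_N` at `z` is that
of the coordinate subspace `{s | s_j = 0 if z_j = 0}` under `Qᵀ`. -/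
theorem isSimplePolyhedron_of_isRegularValueMuN
    (hexact : (torusHom ℂˣ Q).range = (torusHom ℂˣ B).ker)
    (hα : ∀ t : Fin n → ℂˣ, torusHom ℂˣ B (torusHom ℂˣ A t) = t)
    (hreg : IsRegularValueMuN Q a) (hκ : (Q.map (Int.cast : ℤ → ℝ))ᵀ *ᵥ κ = -a) :
    IsSimplePolyhedron (fun j m => (B m j : ℝ)) κ := by
  intro ξ hξ c
  obtain ⟨z, rfl⟩ := exists_momentMap_eq hexact hα hκ hξ
  obtain ⟨w, hw⟩ := hreg z z.2 (-((Q.map (Int.cast : ℤ → ℝ))ᵀ *ᵥ c))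
  rw [fderiv_muN_apply] at hw
  -- A correction of `c`, unchanged where `z` vanishes, lies in the kernel of `Qᵀ`.
  set s : Fin d → ℝ := c + fun k => (starRingEnd ℂ ((z : Fin d → ℂ) k) * w k).re with hs
  have hQs : (Q.map (Int.cast : ℤ → ℝ))ᵀ *ᵥ s = 0 := by
    rw [hs, Matrix.mulVec_add, hw, add_neg_cancel]
  refine ⟨(A.map (Int.cast : ℤ → ℝ))ᵀ *ᵥ s, fun j hj => ?_⟩
  have hzj : (z : Fin d → ℂ) j = 0 := by
    have h := (affineL_momentMap hexact hα hκ z j).symm.trans hj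
    simpa using h
  rw [← transpose_mulVec_apply, transpose_mulVec_transpose_mulVec hexact hα hQs]
  simp [hs, hzj]

theorem exists_circle_zpow_eq_one {c : ℤ} (hc : ¬IsUnit c) : ∃ ζ : Circle, ζ ^ c = 1 ∧ ζ ≠ 1 := by
  by_cases h0 : c = 0
  · exact ⟨Circle.exp Real.pi, by rw [h0, zpow_zero], Circle.exp_pi_ne_one⟩
  have hc0 : (c : ℝ) ≠ 0 := by exact_mod_cast h0
  refine ⟨Circle.exp (2 * Real.pi / c), ?_, fun h => hc ?_⟩
  · rw [← Circle.exp_zsmul, zsmul_eq_mul, mul_div_cancel₀ _ hc0, Circle.exp_two_pi]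
  · obtain ⟨m, hm⟩ := Circle.exp_eq_one.1 h
    have h1 : (1 : ℝ) = c * m := by
      field_simp at hm
      linarith
    exact IsUnit.of_mul_eq_one m (by exact_mod_cast h1.symm)

/-- If `v^j` were divisible by a nonunit `c`, then `c`-torsion elements of the `j`-th coordinate
circle would lie in `N` and fix the points of the level set with `z_j = 0`. -/
theorem isPrimitiveVector_of_actsFreely (hρ : Function.Injective (torusHom ℂˣ Q))
    (hexact : (torusHom ℂˣ Q).range = (torusHom ℂˣ B).ker) (hfree : ActsFreely Q a)
    (z : levelSet Q a) {j : Fin d} (hz : (z : Fin d → ℂ) j = 0) :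
    IsPrimitiveVector fun m => B m j := by
  intro c w hw
  by_contra hc
  obtain ⟨ζ, hζc, hζ⟩ := exists_circle_zpow_eq_one hc
  have hker : torusHom Circle B (Pi.mulSingle j ζ) = 1 := by
    funext m
    have hm : B m j = c * w m := congrFun hw m
    rw [torusHom_mulSingle, hm, zpow_mul, hζc, one_zpow, Pi.one_apply]
  obtain ⟨g, hg⟩ := exists_torusHom_circle_eq hρ hexact hker
  have hfix : torusHom Circle Q g • z = z := by
    rw [hg]
    refine Subtype.ext (funext fun k => ?_)
    change (Pi.mulSingle j ζ : Fin d → Circle) k • (z : Fin d → ℂ) k = (z : Fin d → ℂ) k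
    by_cases hk : k = j
    · rw [hk, hz, smul_zero]
    · rw [Pi.mulSingle_eq_of_ne hk, one_smul]
  rw [hfree g z hfix, map_one] at hg
  apply hζ
  have h := congrFun hg j
  rwa [Pi.mulSingle_eq_same, Pi.one_apply, eq_comm] at h

theorem isPrimitiveInwardNormal_facetSet (hρ : Function.Injective (torusHom ℂˣ Q))
    (hexact : (torusHom ℂˣ Q).range = (torusHom ℂˣ B).ker)
    (hα : ∀ t : Fin n → ℂˣ, torusHom ℂˣ B (torusHom ℂˣ A t) = t) (hfree : ActsFreely Q a)
    (hκ : (Q.map (Int.cast : ℤ → ℝ))ᵀ *ᵥ κ = -a) {j : Fin d}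
    (hne : (facetSet B κ (momentPolytope Q A a κ) j).Nonempty) :
    IsPrimitiveInwardNormal (momentPolytope Q A a κ) (facetSet B κ (momentPolytope Q A a κ) j)
      (fun m => B m j) := by
  refine ⟨?_, ?_, ?_⟩
  · obtain ⟨ξ, hξj, x, rfl⟩ := hne
    obtain ⟨z, rfl⟩ := Quotient.exists_rep x
    refine isPrimitiveVector_of_actsFreely hρ hexact hfree z ?_
    have h := (affineL_momentMap hexact hα hκ z j).symm.trans hξj
    simpa using h
  · rintro x ⟨hx, -⟩ y ⟨hy, -⟩
    simp only [affineL, Set.mem_ofPred_eq] at hx hy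
    rw [dotProduct_sub]
    linarith
  · rintro x ⟨hx, -⟩ y ⟨hy, hyF⟩
    have hy0 : affineL B κ y j ≠ 0 := fun h => hyF ⟨h, hy⟩
    rw [momentPolytope_eq hexact hα hκ] at hy
    have hpos := (hy j).lt_of_ne hy0.symm
    simp only [affineL, Set.mem_ofPred_eq] at hx hpos
    rw [dotProduct_sub]
    linarith

end MomentMap

/-! ### Facets and normals of the moment polytope -/

theorem mainTheorem1 {n d : ℕ} (hnd : n ≤ d)
    (Q : Matrix (Fin d) (Fin (d - n)) ℤ) (B : Matrix (Fin n) (Fin d) ℤ)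
    (A : Matrix (Fin d) (Fin n) ℤ)
    (hρ : Function.Injective (torusHom ℂˣ Q))
    (hexact : (torusHom ℂˣ Q).range = (torusHom ℂˣ B).ker)
    (hβ : Function.Surjective (torusHom ℂˣ B))
    (hα : ∀ t : Fin n → ℂˣ, torusHom ℂˣ B (torusHom ℂˣ A t) = t)
    (a : Fin (d - n) → ℝ) (hreg : IsRegularValueMuN Q a) (hfree : ActsFreely Q a)
    (κ : Fin d → ℝ) (hκ : (Q.map (Int.cast : ℤ → ℝ))ᵀ *ᵥ κ = -a) :
    IsMomentMap Q A a (momentMap Q A a κ) ∧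
    momentPolytope Q A a κ = {ξ | ∀ j, 0 ≤ affineL B κ ξ j} ∧
    Set.BijOn (facetSet B κ (momentPolytope Q A a κ))
      {j | (facetSet B κ (momentPolytope Q A a κ) j).Nonempty}
      {F | IsFacet (momentPolytope Q A a κ) F} ∧
    (∀ j, (facetSet B κ (momentPolytope Q A a κ) j).Nonempty →
      IsPrimitiveInwardNormal (momentPolytope Q A a κ)
        (facetSet B κ (momentPolytope Q A a κ) j) (fun m => B m j)) ∧
    ({F | IsFacet (momentPolytope Q A a κ) F}.ncard = d →
      Set.BijOn (facetSet B κ (momentPolytope Q A a κ)) Set.univ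
        {F | IsFacet (momentPolytope Q A a κ) F} ∧
      ∀ j, IsPrimitiveInwardNormal (momentPolytope Q A a κ)
        (facetSet B κ (momentPolytope Q A a κ) j) (fun m => B m j)) := by

  have hP := momentPolytope_eq hexact hα hκ
  have hbij : Set.BijOn (facetSet B κ (momentPolytope Q A a κ))
      {j | (facetSet B κ (momentPolytope Q A a κ) j).Nonempty}
      {F | IsFacet (momentPolytope Q A a κ) F} := by
    rw [hP]
    exact (isSimplePolyhedron_of_isRegularValueMuN hexact hα hreg hκ).bijOn_face
  have hnormal := fun j hj =>
    isPrimitiveInwardNormal_facetSet (j := j) hρ hexact hα hfree hκ hj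
  refine ⟨isMomentMap_momentMap, hP, hbij, hnormal, fun hcard => ?_⟩
  -- With `d` facets, all the sets `F_j` are nonempty by counting.
  have huniv : {j | (facetSet B κ (momentPolytope Q A a κ) j).Nonempty} = Set.univ := by
    rw [← hbij.image_eq, hbij.injOn.ncard_image] at hcard
    refine Set.eq_of_subset_of_ncard_le (Set.subset_univ _) ?_
    rw [hcard, Set.ncard_univ, Nat.card_fin]
  rw [huniv] at hbij
  exact ⟨hbij, fun j => hnormal j (huniv.ge (Set.mem_univ j))⟩
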